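/- Let $A$ be a finite non-empty alphabet and let $w = a_0a_1a_2\cdots$ be an infinite word over $A$. A finite word $v$ is a \emph{complete first return} to a finite word $u$ if $v$ begins with $u$, ends with $u$, and contains exactly two (possibly overlapping) occurrences of $u$. The \emph{privileged} words over $A$ are defined recursively: the empty word is privileged, every letter of $A$ is privileged, and a word of length at least $2$ is privileged if and only if it is a complete first return to a shorter privileged word. (The empty word has $|v|+1$ occurrences in a finite word $v$.) For $n \ge 0$ let $\mathcal{C}_n(w)$ be the number of distinct factors (blocks of consecutive letters) of $w$ of length $n$, and let $\mathcal{A}_n(w)$ be the number of distinct privileged factors of $w$ of length $n$. The word $w$ is \emph{Sturmian} if $\mathcal{C}_n(w) = n+1$ for all $n \ge 0$. \textbf{Theorem.} An infinite word $w$ over $A$ is Sturmian if and only if, for all $n \ge 0$, \[ \mathcal{A}_n(w) = \begin{cases} 1, & \text{if } n \text{ is even},\\ 2, & \text{if } n \text{ is odd}.\end{cases} \] -/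

import Mathlib

namespace PrivilegedWords

/-- The occurrences of the finite word `u` in the finite word `w`: the positions `i`
(counted from `0`) at which a copy of `u` begins in `w`. The empty word occurs at each of the
`|w| + 1` positions `0, …, |w|`. -/
def occurrences {A : Type*} (u w : List A) : Set ℕ :=
  {i | i ≤ w.length ∧ u <+: w.drop i}

/-- `w` is a complete first return to `u`: it starts and ends with `u` and contains exactly two
occurrences of `u`. -/
def IsCompleteFirstReturn {A : Type*} (w u : List A) : Prop :=
  u <+: w ∧ u <:+ w ∧ (occurrences u w).ncard = 2

/-- Privileged words: the empty word, the letters, and every word of length at least two that is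
a complete first return to a shorter privileged word. -/
inductive IsPrivileged {A : Type*} : List A → Prop
  | nil : IsPrivileged []
  | letter (a : A) : IsPrivileged [a]
  | completeReturn (w u : List A) : 2 ≤ w.length → u.length < w.length → IsPrivileged u →
      IsCompleteFirstReturn w u → IsPrivileged w

/-- The finite word `u` is a factor of the infinite word `w`, that is
`u = w i, w (i + 1), …, w (i + |u| - 1)` for some position `i`. -/
def IsFactor {A : Type*} (u : List A) (w : ℕ → A) : Prop :=
  ∃ i : ℕ, u = (List.range u.length).map fun k => w (i + k)

/-- The set of factors of length `n` of the infinite word `w`. -/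
def factors {A : Type*} (w : ℕ → A) (n : ℕ) : Set (List A) :=
  {u | u.length = n ∧ IsFactor u w}

/-- The factor complexity function of `w`: the number of distinct factors of length `n`. -/
noncomputable def factorComplexity {A : Type*} (w : ℕ → A) (n : ℕ) : ℕ :=
  (factors w n).ncard

/-- The privileged complexity function of `w`: the number of distinct privileged factors of
length `n`. -/
noncomputable def privilegedComplexity {A : Type*} (w : ℕ → A) (n : ℕ) : ℕ :=
  {u | u ∈ factors w n ∧ IsPrivileged u}.ncard

/-- An infinite word is Sturmian if it has exactly `n + 1` factors of length `n`, for all `n`. -/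
def IsSturmian {A : Type*} (w : ℕ → A) : Prop :=
  ∀ n : ℕ, factorComplexity w n = n + 1

end PrivilegedWords

/-! The bridge between the two conditions is the palindromes: for a word satisfying either one, a
factor is privileged exactly when it is a palindrome. Since `w` is not known to be recurrent
beforehand, the argument works with the words that occur infinitely often and compares them with all
factors only at the end.

Both conditions force two recurring letters and exclude eventual periodicity, so there are right
special words of every length. `SturmianUpTo` is then propagated by induction on length: closure
under reversal, at most one right special word of each smaller length, and 1 or 2 palindromes
according to parity. The engine is the bispecial palindrome `r`. Between consecutive occurrences of
`r` every letter is forced, and reversal closure forces letters backwards too, so returns to `r` are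
palindromes (`letter_eq`, `reverse_return`) and both mixed extensions of `r` recur (`recurs_mixed`).

The induction (`step`) can fail only if both `c r c` and `d r d` recur with `c ≠ d`. Under the
Sturmian hypothesis this would give two right special words of the same length, too many for the
complexity. Under the privileged hypothesis it would give too many palindromes of length `m + 2`,
all of them privileged. -/

namespace PrivilegedWords

variable {A : Type*}

/-! ### Blocks of an infinite word -/

/-- The block of length `n` of the infinite word `w` that starts at position `i`. -/
def window (w : ℕ → A) (i n : ℕ) : List A := (List.range n).map fun k => w (i + k)

@[simp] theorem length_window (w : ℕ → A) (i n : ℕ) : (window w i n).length = n := by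
  simp [window]

@[simp] theorem getElem_window (w : ℕ → A) (i n k : ℕ) (h : k < (window w i n).length) :
    (window w i n)[k] = w (i + k) := by
  simp [window]

theorem window_add (w : ℕ → A) (i m n : ℕ) :
    window w i (m + n) = window w i m ++ window w (i + m) n := by
  simp [window, List.range_add, Function.comp_def, Nat.add_assoc]

theorem window_succ (w : ℕ → A) (i n : ℕ) :
    window w i (n + 1) = window w i n ++ [w (i + n)] := by
  rw [window_add]; rfl

theorem window_succ' (w : ℕ → A) (i n : ℕ) :
    window w i (n + 1) = w i :: window w (i + 1) n := by
  rw [add_comm, window_add]; rfl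

theorem window_eq_iff {w : ℕ → A} {i j n : ℕ} :
    window w i n = window w j n ↔ ∀ k < n, w (i + k) = w (j + k) := by
  simp [window]

theorem reverse_window_eq_iff {w : ℕ → A} {i j n : ℕ} :
    (window w i n).reverse = window w j n ↔ ∀ k < n, w (i + (n - 1 - k)) = w (j + k) := by
  constructor
  · intro h k hk
    have := congrArg (fun l : List A => l[k]?) h
    simpa [hk, List.getElem?_eq_getElem, List.getElem_reverse] using this
  · intro h
    apply List.ext_getElem (by simp)
    intro k h1 h2
    simp only [length_window] at h2
    simpa [List.getElem_reverse] using h k h2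

theorem window_drop (w : ℕ → A) (i n p : ℕ) :
    (window w i n).drop p = window w (i + p) (n - p) := by
  apply List.ext_getElem (by simp)
  intro k h1 h2
  simp [Nat.add_assoc]

theorem window_take (w : ℕ → A) (i n p : ℕ) (h : p ≤ n) :
    (window w i n).take p = window w i p := by
  apply List.ext_getElem (by simp [h])
  intro k h1 h2
  simp

theorem isFactor_iff {w : ℕ → A} {u : List A} :
    IsFactor u w ↔ ∃ i, window w i u.length = u :=
  ⟨fun ⟨i, h⟩ => ⟨i, h.symm⟩, fun ⟨i, h⟩ => ⟨i, h.symm⟩⟩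

theorem isFactor_window (w : ℕ → A) (i n : ℕ) : IsFactor (window w i n) w :=
  isFactor_iff.2 ⟨i, by simp⟩

theorem mem_factors_iff {w : ℕ → A} {n : ℕ} {u : List A} :
    u ∈ factors w n ↔ ∃ i, window w i n = u := by
  constructor
  · rintro ⟨rfl, h⟩
    exact isFactor_iff.1 h
  · rintro ⟨i, rfl⟩
    exact ⟨by simp, isFactor_window w i n⟩

theorem prefix_window_iff {w : ℕ → A} {i n : ℕ} {u : List A} :
    u <+: window w i n ↔ u.length ≤ n ∧ window w i u.length = u := by
  constructor
  · intro h
    have hl : u.length ≤ n := by simpa using h.length_le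
    refine ⟨hl, ?_⟩
    rw [List.prefix_iff_eq_take, window_take _ _ _ _ hl] at h
    exact h.symm
  · rintro ⟨hl, h⟩
    rw [List.prefix_iff_eq_take, window_take _ _ _ _ hl, h]

theorem suffix_window_iff {w : ℕ → A} {i n : ℕ} {u : List A} :
    u <:+ window w i n ↔ u.length ≤ n ∧ window w (i + (n - u.length)) u.length = u := by
  constructor
  · intro h
    have hl : u.length ≤ n := by simpa using h.length_le
    refine ⟨hl, ?_⟩
    rw [List.suffix_iff_eq_drop, window_drop, length_window, Nat.sub_sub_self hl] at h
    exact h.symm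
  · rintro ⟨hl, h⟩
    rw [List.suffix_iff_eq_drop, window_drop, length_window, Nat.sub_sub_self hl, h]

theorem mem_occurrences_window {w : ℕ → A} {i n p : ℕ} {u : List A} :
    p ∈ occurrences u (window w i n) ↔
      p + u.length ≤ n ∧ window w (i + p) u.length = u := by
  simp only [occurrences, Set.mem_ofPred_eq, length_window, window_drop, prefix_window_iff]
  constructor
  · rintro ⟨h1, h2, h3⟩
    exact ⟨by omega, h3⟩
  · rintro ⟨h1, h3⟩
    exact ⟨by omega, by omega, h3⟩

/-! ### Consecutive occurrences and complete first returns -/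

/-- `i < j` are consecutive positions at which the word `u` occurs in `w`. -/
structure IsReturn (w : ℕ → A) (u : List A) (i j : ℕ) : Prop where
  lt : i < j
  left : window w i u.length = u
  right : window w j u.length = u
  between : ∀ x, i < x → x < j → window w x u.length ≠ u

theorem IsReturn.isCompleteFirstReturn {w : ℕ → A} {u : List A} {i j : ℕ}
    (h : IsReturn w u i j) : IsCompleteFirstReturn (window w i (j - i + u.length)) u := by
  have hlt := h.lt
  refine ⟨prefix_window_iff.2 ⟨by omega, h.left⟩, suffix_window_iff.2 ⟨by omega, ?_⟩, ?_⟩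
  · rw [Nat.add_sub_cancel, Nat.add_sub_cancel' hlt.le]; exact h.right
  · have : occurrences u (window w i (j - i + u.length)) = {0, j - i} := by
      ext p
      rw [mem_occurrences_window]
      simp only [Set.mem_insert_iff, Set.mem_singleton_iff]
      constructor
      · rintro ⟨h1, h2⟩
        by_contra! hp
        exact h.between (i + p) (by omega) (by omega) h2
      · rintro (rfl | rfl)
        · exact ⟨by omega, h.left⟩
        · refine ⟨le_rfl, ?_⟩
          rw [Nat.add_sub_cancel' hlt.le]; exact h.right
    rw [this, Set.ncard_pair (by omega)]

theorem IsCompleteFirstReturn.isReturn {w : ℕ → A} {u : List A} {i n : ℕ}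
    (h : IsCompleteFirstReturn (window w i n) u) (hn : u.length < n) :
    IsReturn w u i (i + (n - u.length)) := by
  obtain ⟨h1, h2, h3⟩ := h
  rw [prefix_window_iff] at h1
  rw [suffix_window_iff] at h2
  refine ⟨by omega, h1.2, h2.2, fun x hx1 hx2 hx => ?_⟩
  have hsub : ({0, n - u.length, x - i} : Set ℕ) ⊆ occurrences u (window w i n) := by
    rintro p (rfl | rfl | rfl)
    · exact mem_occurrences_window.2 ⟨by omega, h1.2⟩
    · exact mem_occurrences_window.2 ⟨by omega, h2.2⟩
    · exact mem_occurrences_window.2 ⟨by omega, by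
        rw [Nat.add_sub_cancel' hx1.le]; exact hx⟩
  have hfin : (occurrences u (window w i n)).Finite := Set.finite_of_ncard_ne_zero (by omega)
  have := Set.ncard_le_ncard hsub hfin
  rw [h3, Set.ncard_eq_three.2 ⟨0, n - u.length, x - i, by omega, by omega, by omega, rfl⟩] at this
  omega

theorem IsCompleteFirstReturn.isPrivileged {v u : List A} (h : IsCompleteFirstReturn v u)
    (hl : u.length < v.length) (hu : IsPrivileged u) : IsPrivileged v := by
  match v, hl, h with
  | [a], _, _ => exact .letter a
  | a :: b :: v, hl, h => exact .completeReturn _ u (by simp) hl hu h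

theorem IsReturn.isPrivileged {w : ℕ → A} {u : List A} {i j : ℕ} (h : IsReturn w u i j)
    (hu : IsPrivileged u) : IsPrivileged (window w i (j - i + u.length)) :=
  h.isCompleteFirstReturn.isPrivileged (by have := h.lt; simp; omega) hu

theorem exists_isReturn_of_lt {w : ℕ → A} {u : List A} {i x : ℕ} (hix : i < x)
    (hi : window w i u.length = u) (hx : window w x u.length = u) :
    ∃ j ≤ x, IsReturn w u i j := by
  classical
  have hex : ∃ j, i < j ∧ window w j u.length = u := ⟨x, hix, hx⟩
  refine ⟨Nat.find hex, Nat.find_min' hex ⟨hix, hx⟩, (Nat.find_spec hex).1, hi,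
    (Nat.find_spec hex).2, fun y h1 h2 h3 => Nat.find_min hex h2 ⟨h1, h3⟩⟩

theorem exists_isReturn_of_gt {w : ℕ → A} {u : List A} {x j : ℕ} (hxj : x < j)
    (hx : window w x u.length = u) (hj : window w j u.length = u) :
    ∃ i ≥ x, IsReturn w u i j := by
  classical
  set P : ℕ → Prop := fun y => y < j ∧ window w y u.length = u
  have hP : P x := ⟨hxj, hx⟩
  obtain ⟨h1, h2⟩ : P (Nat.findGreatest P j) := Nat.findGreatest_spec (P := P) hxj.le hP
  refine ⟨_, Nat.le_findGreatest hxj.le hP, h1, h2, hj, fun y hy1 hy2 hy3 => ?_⟩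
  exact Nat.findGreatest_is_greatest hy1 hy2.le ⟨hy2, hy3⟩

/-! ### Recurring and right special words -/

/-- The word `u` occurs infinitely often in `w`. -/
def Recurs (w : ℕ → A) (u : List A) : Prop := ∀ N, ∃ i ≥ N, window w i u.length = u

theorem Recurs.isFactor {w : ℕ → A} {u : List A} (h : Recurs w u) : IsFactor u w := by
  obtain ⟨i, -, hi⟩ := h 0
  exact isFactor_iff.2 ⟨i, hi⟩

theorem Recurs.left {w : ℕ → A} {u v : List A} (h : Recurs w (u ++ v)) : Recurs w u := by
  intro N
  obtain ⟨i, hi, h⟩ := h N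
  rw [List.length_append, window_add] at h
  exact ⟨i, hi, (List.append_inj h (by simp)).1⟩

theorem Recurs.right {w : ℕ → A} {u v : List A} (h : Recurs w (u ++ v)) : Recurs w v := by
  intro N
  obtain ⟨i, hi, h⟩ := h N
  rw [List.length_append, window_add] at h
  exact ⟨i + u.length, by omega, (List.append_inj h (by simp)).2⟩

theorem Recurs.tail {w : ℕ → A} {c : A} {u : List A} (h : Recurs w (c :: u)) : Recurs w u :=
  Recurs.right (u := [c]) h

theorem recurs_nil (w : ℕ → A) : Recurs w [] := fun N => ⟨N, le_rfl, rfl⟩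

theorem finite_length_eq [Finite A] (n : ℕ) : {u : List A | u.length = n}.Finite :=
  List.finite_length_eq A n

/-- There are finitely many words of length `n`, and each one that does not recur is absent from
some position on. -/
theorem eventually_recurs_window [Finite A] (w : ℕ → A) (n : ℕ) :
    ∃ N, ∀ i ≥ N, Recurs w (window w i n) := by
  have key : ∀ u : List A, ∃ N, ¬ Recurs w u → ∀ i ≥ N, window w i u.length ≠ u := by
    intro u
    by_cases h : Recurs w u
    · exact ⟨0, fun h' => absurd h h'⟩
    · unfold Recurs at h
      push Not at h
      obtain ⟨N, hN⟩ := h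
      exact ⟨N, fun _ => hN⟩
  choose f hf using key
  obtain ⟨N, hN⟩ := ((finite_length_eq (A := A) n).image f).bddAbove
  refine ⟨N, fun i hi => ?_⟩
  by_contra hrec
  refine hf _ hrec i (le_trans (hN ⟨window w i n, by simp, rfl⟩) hi) (by simp)

theorem Recurs.exists_append [Finite A] {w : ℕ → A} {u : List A} (h : Recurs w u) :
    ∃ c, Recurs w (u ++ [c]) := by
  obtain ⟨N, hN⟩ := eventually_recurs_window w (u.length + 1)
  obtain ⟨i, hi, hu⟩ := h N
  have := hN i hi
  rw [window_succ, hu] at this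
  exact ⟨_, this⟩

theorem Recurs.exists_cons [Finite A] {w : ℕ → A} {u : List A} (h : Recurs w u) :
    ∃ c, Recurs w (c :: u) := by
  obtain ⟨N, hN⟩ := eventually_recurs_window w (u.length + 1)
  obtain ⟨i, hi, hu⟩ := h (N + 1)
  obtain ⟨i, rfl⟩ : ∃ k, i = k + 1 := ⟨i - 1, by omega⟩
  have := hN i (by omega)
  rw [window_succ', hu] at this
  exact ⟨_, this⟩

/-- `u` can be continued to the right by two different letters, each infinitely often. -/
def RightSpecial (w : ℕ → A) (u : List A) : Prop :=
  ∃ c d, c ≠ d ∧ Recurs w (u ++ [c]) ∧ Recurs w (u ++ [d])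

theorem eq_of_not_rightSpecial {w : ℕ → A} {u : List A} (h : ¬ RightSpecial w u) {c d : A}
    (hc : Recurs w (u ++ [c])) (hd : Recurs w (u ++ [d])) : c = d := by
  by_contra hne
  exact h ⟨c, d, hne, hc, hd⟩

theorem RightSpecial.recurs {w : ℕ → A} {u : List A} (h : RightSpecial w u) : Recurs w u := by
  obtain ⟨c, d, -, h, -⟩ := h
  exact h.left

theorem RightSpecial.right {w : ℕ → A} {u v : List A} (h : RightSpecial w (u ++ v)) :
    RightSpecial w v := by
  obtain ⟨c, d, hcd, h1, h2⟩ := h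
  rw [List.append_assoc] at h1 h2
  exact ⟨c, d, hcd, h1.right, h2.right⟩

/-! ### Eventual periodicity -/

/-- From some position on, the letters of `w` are determined by the preceding block of some
fixed length. -/
def EventuallyDetermined (w : ℕ → A) : Prop :=
  ∃ j N, ∀ i ≥ N, ∀ i' ≥ N, window w i j = window w i' j → w (i + j) = w (i' + j)

theorem exists_rightSpecial [Finite A] {w : ℕ → A} (h : ¬ EventuallyDetermined w) (n : ℕ) :
    ∃ u, u.length = n ∧ RightSpecial w u := by
  by_contra! hno
  refine h ⟨n, ?_⟩
  obtain ⟨N, hN⟩ := eventually_recurs_window w (n + 1)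
  refine ⟨N, fun i hi i' hi' heq => ?_⟩
  have h1 := hN i hi
  have h2 := hN i' hi'
  rw [window_succ] at h1 h2
  rw [← heq] at h2
  exact eq_of_not_rightSpecial (hno _ (by simp)) h1 h2

/-- By pigeonhole a block of the determining length repeats, and determinism keeps the two
continuations equal for ever. -/
theorem EventuallyDetermined.exists_period [Finite A] {w : ℕ → A} (h : EventuallyDetermined w) :
    ∃ i i', i < i' ∧ ∀ k, w (i + k) = w (i' + k) := by
  obtain ⟨j, N, h⟩ := h
  obtain ⟨x, hx, y, hy, hxy, heq⟩ : ∃ x ∈ Set.Ici N, ∃ y ∈ Set.Ici N, x < y ∧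
      window w x j = window w y j := by
    obtain ⟨x, hx, y, hy, hne, heq⟩ := (Set.Ici_infinite N).exists_ne_map_eq_of_mapsTo
      (f := fun i => window w i j) (t := {u : List A | u.length = j})
      (fun i _ => by simp) (finite_length_eq j)
    rcases lt_or_gt_of_ne hne with h | h
    · exact ⟨x, hx, y, hy, h, heq⟩
    · exact ⟨y, hy, x, hx, h, heq.symm⟩
  have hx' : N ≤ x := hx
  have hy' : N ≤ y := hy
  have key : ∀ k, window w (x + k) j = window w (y + k) j := by
    intro k
    induction k with
    | zero => exact heq
    | succ k ih =>
      have h1 : window w (x + k) (j + 1) = window w (y + k) (j + 1) := by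
        rw [window_succ, window_succ, ih, h _ (by omega) _ (by omega) ih]
      rw [window_succ', window_succ'] at h1
      exact (List.cons.inj h1).2
  refine ⟨x + j, y + j, by omega, fun k => ?_⟩
  have := h (x + k) (by omega) (y + k) (by omega) (key k)
  rwa [add_right_comm, add_right_comm y] at this

theorem eventuallyDetermined_of_period {w : ℕ → A} {i i' : ℕ} (hlt : i < i')
    (h : ∀ k, w (i + k) = w (i' + k)) : EventuallyDetermined w := by
  refine ⟨i' - i, i, fun x hx y hy hxy => ?_⟩
  have key : ∀ z ≥ i, w (z + (i' - i)) = w z := by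
    intro z hz
    have := h (z - i)
    rw [show i + (z - i) = z by omega, show i' + (z - i) = z + (i' - i) by omega] at this
    exact this.symm
  rw [key x hx, key y hy]
  simpa using window_eq_iff.1 hxy 0 (by omega)

theorem EventuallyDetermined.exists_bound [Finite A] {w : ℕ → A} (h : EventuallyDetermined w) :
    ∃ B, ∀ n i, ∃ i' < B, window w i' n = window w i n := by
  obtain ⟨x, y, hxy, hper⟩ := h.exists_period
  refine ⟨y, fun n i => ?_⟩
  induction i using Nat.strong_induction_on with
  | _ i ih =>
    by_cases hi : i < y
    · exact ⟨i, hi, rfl⟩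
    · obtain ⟨i', h1, h2⟩ := ih (i - (y - x)) (by omega)
      refine ⟨i', h1, h2.trans (window_eq_iff.2 fun k _ => ?_)⟩
      have := hper (i - y + k)
      rwa [show x + (i - y + k) = i - (y - x) + k by omega,
        show y + (i - y + k) = i + k by omega] at this

/-! ### Two letters, reversal and forced continuation -/

/-- Only two letters occur infinitely often in `w`. -/
def Binary (w : ℕ → A) : Prop :=
  ∀ c d e, Recurs w [c] → Recurs w [d] → Recurs w [e] → c ≠ d → e = c ∨ e = d

theorem binary_of_ncard_factors [Finite A] {w : ℕ → A} (h : (factors w 1).ncard = 2) :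
    Binary w := by
  intro c d e hc hd he hcd
  by_contra! hne
  have hsub : ({[c], [d], [e]} : Set (List A)) ⊆ factors w 1 := by
    rintro u (rfl | rfl | rfl)
    exacts [⟨rfl, hc.isFactor⟩, ⟨rfl, hd.isFactor⟩, ⟨rfl, he.isFactor⟩]
  have hfin : (factors w 1).Finite := Set.finite_of_ncard_ne_zero (by omega)
  have := Set.ncard_le_ncard hsub hfin
  rw [h, Set.ncard_eq_three.2 ⟨[c], [d], [e], by simpa using hcd, by simpa using hne.1.symm,
    by simpa using hne.2.symm, rfl⟩] at this
  omega

/-- The language of blocks of length `n` that occur infinitely often is closed under reversal. -/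
def ReversalClosed (w : ℕ → A) (n : ℕ) : Prop :=
  ∀ u : List A, u.length = n → Recurs w u → Recurs w u.reverse

theorem ReversalClosed.pred [Finite A] {w : ℕ → A} {n : ℕ} (h : ReversalClosed w (n + 1)) :
    ReversalClosed w n := by
  intro u hu hr
  obtain ⟨c, hc⟩ := hr.exists_append
  have := h _ (by simp [hu]) hc
  rw [List.reverse_append] at this
  exact this.right

theorem ReversalClosed.mono [Finite A] {w : ℕ → A} {m n : ℕ} (hmn : m ≤ n)
    (h : ReversalClosed w n) : ReversalClosed w m := by
  induction n, hmn using Nat.le_induction with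
  | base => exact h
  | succ n _ ih => exact ih h.pred

/-- Reading forwards from `i` and backwards from `i'` gives the same letters as long as no right
special block is met. -/
theorem mirror {w : ℕ → A} {m N : ℕ} (hrev : ReversalClosed w (m + 1))
    (hN : ∀ i ≥ N, Recurs w (window w i (m + 1))) {i i' s t : ℕ} (hi : N ≤ i)
    (hst : s ≤ t) (hi' : N + (m + t) ≤ i' + 1)
    (hstart : ∀ k < m + s, w (i + k) = w (i' - k))
    (hns : ∀ x, s ≤ x → x < t → ¬ RightSpecial w (window w (i + x) m)) :
    ∀ k < m + t, w (i + k) = w (i' - k) := by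
  induction t, hst using Nat.le_induction with
  | base => exact hstart
  | succ t hst ih =>
    have ih := ih (by omega) fun x h1 h2 => hns x h1 (by omega)
    intro k hk
    rcases Nat.lt_or_ge k (m + t) with h | h
    · exact ih k h
    · obtain rfl : k = m + t := by omega
      have h1 := hN (i + t) (by omega)
      -- The bound on `i'` keeps the backward reading at positions at least `N`. The forward block
      -- and the reversed backward block are now recurring one-letter extensions of the same word,
      -- which is not right special.
      have h2 := hrev _ (by simp) (hN (i' - (m + t)) (by omega))
      rw [window_succ] at h1
      rw [window_succ', List.reverse_cons] at h2
      have h3 : (window w (i' - (m + t) + 1) m).reverse = window w (i + t) m := by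
        rw [reverse_window_eq_iff]
        intro x hx
        have := ih (t + x) (by omega)
        rw [show i + t + x = i + (t + x) by omega, this]
        congr 1
        omega
      rw [h3] at h2
      have := eq_of_not_rightSpecial (hns t hst (by omega)) h1 h2
      rwa [show i + t + m = i + (m + t) by omega] at this

/-- Reading forwards from `i` and from `i'` gives the same letters as long as no right special
block is met. -/
theorem window_determined {w : ℕ → A} {m N : ℕ}
    (hN : ∀ i ≥ N, Recurs w (window w i (m + 1))) {i i' s t : ℕ} (hi : N ≤ i) (hi' : N ≤ i')
    (hst : s ≤ t) (hstart : ∀ k < m + s, w (i + k) = w (i' + k))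
    (hns : ∀ x, s ≤ x → x < t → ¬ RightSpecial w (window w (i + x) m)) :
    ∀ k < m + t, w (i + k) = w (i' + k) := by
  induction t, hst using Nat.le_induction with
  | base => exact hstart
  | succ t hst ih =>
    have ih := ih fun x h1 h2 => hns x h1 (by omega)
    intro k hk
    rcases Nat.lt_or_ge k (m + t) with h | h
    · exact ih k h
    · obtain rfl : k = m + t := by omega
      have h1 := hN (i + t) (by omega)
      have h2 := hN (i' + t) (by omega)
      rw [window_succ] at h1 h2
      have h3 : window w (i' + t) m = window w (i + t) m := by
        rw [window_eq_iff]
        intro x hx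
        have := ih (t + x) (by omega)
        rw [add_assoc, add_assoc, this]
      rw [h3] at h2
      have := eq_of_not_rightSpecial (hns t hst (by omega)) h1 h2
      rwa [show i + t + m = i + (m + t) by omega,
        show i' + t + m = i' + (m + t) by omega] at this

/-! ### Returns to a bispecial palindrome -/

/-- The palindrome `r` is the only right special word of length `m`, and the blocks of length
`m + 1` that recur are closed under reversal. -/
structure BispecialPalindrome (w : ℕ → A) (m : ℕ) (r : List A) : Prop where
  length : r.length = m
  palindrome : r.reverse = r
  special : RightSpecial w r
  unique : ∀ u : List A, u.length = m → RightSpecial w u → u = r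
  closed : ReversalClosed w (m + 1)

namespace BispecialPalindrome

variable {w : ℕ → A} {m : ℕ} {r : List A}

theorem not_rightSpecial (hr : BispecialPalindrome w m r) {i j : ℕ} (h : IsReturn w r i j) :
    ∀ x, 1 ≤ x → x < j - i → ¬ RightSpecial w (window w (i + x) m) := by
  intro x h1 h2 hs
  have := hr.unique _ (by simp) hs
  exact h.between (i + x) (by omega) (by omega) (by rw [hr.length]; exact this)

/-- The letter after `r` determines the whole return, because no right special block is met before
`r` comes back. -/
theorem agree (hr : BispecialPalindrome w m r) {N : ℕ}
    (hN : ∀ i ≥ N, Recurs w (window w i (m + 1))) {i j i' j' : ℕ} (hi : N ≤ i) (hi' : N ≤ i')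
    (h : IsReturn w r i j) (h' : IsReturn w r i' j') (hc : w (i + m) = w (i' + m)) :
    (∀ k < m + (j - i), w (i + k) = w (i' + k)) ∧ j' - i' ≤ j - i := by
  have hlt := h.lt
  have hl := hr.length
  -- Offset 0 carries `r` itself, which is right special; `hc` supplies that one choice, so
  -- determinism starts at `s = 1`.
  have key := window_determined hN hi hi' (s := 1) (t := j - i) (by omega) (by
    intro k hk
    rcases Nat.lt_or_ge k m with hk' | hk'
    · exact window_eq_iff.1 (hl ▸ h.left.trans h'.left.symm) k hk'
    · obtain rfl : k = m := by omega
      exact hc) (hr.not_rightSpecial h)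
  refine ⟨key, ?_⟩
  by_contra! hlt'
  refine h'.between (i' + (j - i)) (by omega) (by omega) ?_
  rw [← h.right, length_window, hl, window_eq_iff]
  intro k hk
  have := key (j - i + k) (by omega)
  rw [add_assoc, ← this]
  congr 1
  omega

theorem last_letter_eq (hr : BispecialPalindrome w m r) {N : ℕ}
    (hN : ∀ i ≥ N, Recurs w (window w i (m + 1))) {i j i' j' : ℕ} (hi : N ≤ i) (hi' : N ≤ i')
    (h : IsReturn w r i j) (h' : IsReturn w r i' j') (hc : w (i + m) = w (i' + m)) :
    w (j - 1) = w (j' - 1) := by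
  obtain ⟨h1, h2⟩ := hr.agree hN hi hi' h h' hc
  obtain ⟨-, h3⟩ := hr.agree hN hi' hi h' h hc.symm
  have := h.lt
  have := h'.lt
  have := h1 (j - i - 1) (by omega)
  rwa [show i + (j - i - 1) = j - 1 by omega, show i' + (j - i - 1) = j' - 1 by omega] at this

/-- A palindrome of length `m + 1` lies in the centre of a return whose first and last new
letters agree. -/
theorem exists_symmetric_return (hr : BispecialPalindrome w m r) {N : ℕ}
    (hN : ∀ i ≥ N, Recurs w (window w i (m + 1)))
    {z : List A} (hz : Recurs w z) (hzl : z.length = m + 1) (hzp : z.reverse = z) :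
    ∃ i j, N ≤ i ∧ IsReturn w r i j ∧ w (i + m) = w (j - 1) := by
  have hl := hr.length
  obtain ⟨x, hx, hxr⟩ := hr.special.recurs N
  obtain ⟨p, hp, hpz⟩ := hz x
  obtain ⟨y, hy, hyr⟩ := hr.special.recurs (p + 1)
  rw [hl] at hxr hyr
  rw [hzl] at hpz
  classical
  have hex : ∃ t, window w (p + 1 + t) m = r :=
    ⟨y - (p + 1), by rw [Nat.add_sub_cancel' hy]; exact hyr⟩
  obtain ⟨t, ht, hmin⟩ : ∃ t, window w (p + 1 + t) m = r ∧
      ∀ s < t, window w (p + 1 + s) m ≠ r :=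
    ⟨Nat.find hex, Nat.find_spec hex, fun s hs => Nat.find_min hex hs⟩
  have hstart : ∀ k < m + 1, w (p + k) = w (p + m - k) := by
    rw [← hpz, reverse_window_eq_iff] at hzp
    intro k hk
    rw [← hzp k hk]
    congr 1
    omega
  have hmir : ∀ t', t' ≤ t → t' ≤ p - N → ∀ k < m + (t' + 1), w (p + k) = w (p + m - k) := by
    intro t' h1 h2
    refine mirror hr.closed hN (s := 1) (by omega) (by omega) (by omega) hstart ?_
    intro x' hx1 hx2 hs
    have := hr.unique _ (by simp) hs
    exact hmin (x' - 1) (by omega) (by rwa [show p + 1 + (x' - 1) = p + x' by omega])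
  have hback : ∀ t', t' ≤ t → t' ≤ p - N →
      (window w (p + 1 + t') m).reverse = window w (p - t') m := by
    intro t' h1 h2
    rw [reverse_window_eq_iff]
    intro k hk
    have := hmir t' h1 h2 (t' + 1 + (m - 1 - k)) (by omega)
    rw [show p + 1 + t' + (m - 1 - k) = p + (t' + 1 + (m - 1 - k)) by omega, this]
    congr 1
    omega
  -- Otherwise the occurrence of `r` at `x` would be mirrored to one before offset `t`. This also
  -- keeps `p - t` at least `N`.
  have htp : t ≤ p - x := by
    by_contra! hlt
    have := hback (p - x) (by omega) (by omega)
    rw [show p - (p - x) = x by omega, hxr] at this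
    refine hmin _ hlt ?_
    rw [← hr.palindrome, ← this, List.reverse_reverse]
  refine ⟨p - t, p + 1 + t, by omega, ⟨by omega, ?_, by rwa [hl], ?_⟩, ?_⟩
  · rw [hl, ← hback t le_rfl (by omega), ht, hr.palindrome]
  · intro y' h1 h2 h3
    rw [hl] at h3
    rcases Nat.lt_or_ge p y' with h | h
    · exact hmin (y' - (p + 1)) (by omega) (by rwa [Nat.add_sub_cancel' h])
    · have := hback (p - y') (by omega) (by omega)
      rw [Nat.sub_sub_self h, h3] at this
      refine hmin (p - y') (by omega) ?_
      rw [← hr.palindrome, ← this, List.reverse_reverse]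
  · have := hmir t le_rfl (by omega) t (by omega)
    rw [show p + 1 + t - 1 = p + t by omega, this]
    congr 1
    omega

theorem recurs_cons_of_recurs_append (hr : BispecialPalindrome w m r) {c : A}
    (h : Recurs w (r ++ [c])) : Recurs w (c :: r) := by
  have := hr.closed _ (by simp [hr.length]) h
  rwa [List.reverse_append, hr.palindrome] at this

/-- A return is determined by its first new letter, so there are two kinds. One is symmetric because
of `z`; the other must end in the other letter, since that letter followed by `r` recurs and so
closes some return. -/
theorem letter_eq (hr : BispecialPalindrome w m r) (hb : Binary w) {N : ℕ}
    (hN : ∀ i ≥ N, Recurs w (window w i (m + 1))) {z : List A} (hz : Recurs w z)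
    (hzl : z.length = m + 1) (hzp : z.reverse = z) {i j : ℕ} (hi : N ≤ i)
    (h : IsReturn w r i j) : w (i + m) = w (j - 1) := by
  have hl := hr.length
  obtain ⟨i₀, j₀, hi₀, h₀, hc⟩ := hr.exists_symmetric_return hN hz hzl hzp
  by_cases heq : w (i + m) = w (i₀ + m)
  · rw [heq, hc]
    exact (hr.last_letter_eq hN hi hi₀ h h₀ heq).symm
  have hext : ∀ i ≥ N, window w i r.length = r → Recurs w (r ++ [w (i + m)]) := by
    intro i hi h
    have := hN i hi
    rwa [window_succ, ← hl, h, hl] at this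
  have hbin : ∀ e, Recurs w [e] → e = w (i₀ + m) ∨ e = w (i + m) := fun e he =>
    hb _ _ _ (hext i₀ hi₀ h₀.left).right (hext i hi h.left).right he (Ne.symm heq)
  have hcr : ∀ i ≥ N, Recurs w [w i] := by
    intro i hi
    have := hN i hi
    rw [window_succ'] at this
    exact this.left (u := [w i])
  have hj1 : N ≤ j - 1 := by have := h.lt; omega
  rcases hbin _ (hcr (j - 1) hj1) with h1 | h1
  -- Here both kinds of return would end in the same letter, yet `w (i + m)` also precedes `r`
  -- infinitely often.
  · exfalso
    obtain ⟨x, hx, hxr⟩ := hr.special.recurs N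
    obtain ⟨y, hy, hyr⟩ := hr.recurs_cons_of_recurs_append (hext i hi h.left) (x + 1)
    rw [List.length_cons, window_succ'] at hyr
    obtain ⟨hy1, hy2⟩ := List.cons.inj hyr
    obtain ⟨i', hi', h'⟩ := exists_isReturn_of_gt (show x < y + 1 by omega) hxr hy2
    have hlast : w (y + 1 - 1) = w (i₀ + m) := by
      rcases hbin _ (hext i' (by omega) h'.left).right with h2 | h2
      · rw [hr.last_letter_eq hN (by omega) hi₀ h' h₀ h2, ← hc]
      · rw [hr.last_letter_eq hN (by omega) hi h' h h2, h1]
    rw [Nat.add_sub_cancel, hy1] at hlast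
    exact heq hlast
  · exact h1.symm

/-- Follow the successive occurrences of `r` from one followed by `c` to one followed by `d`. At the
first change the preceding return began with `c`, hence also ended with `c`. -/
theorem recurs_mixed (hr : BispecialPalindrome w m r) [Finite A] (hb : Binary w)
    {z : List A} (hz : Recurs w z) (hzl : z.length = m + 1) (hzp : z.reverse = z) {c d : A}
    (hcd : c ≠ d) (hc : Recurs w (r ++ [c])) (hd : Recurs w (r ++ [d])) :
    Recurs w (c :: (r ++ [d])) := by
  have hl := hr.length
  obtain ⟨N, hN⟩ := eventually_recurs_window w (m + 1)
  intro N'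
  have key : ∀ n i i', i' - i ≤ n → i < i' → N ≤ i → N' ≤ i → window w i m = r →
      window w i' m = r → w (i + m) = c → w (i' + m) = d →
      ∃ j > i, window w j m = r ∧ w (j - 1) = c ∧ w (j + m) = d := by
    intro n
    induction n with
    | zero => intro i i' h1 h2; omega
    | succ n ih =>
      intro i i' h1 h2 h3 h4 h5 h6 h7 h8
      obtain ⟨j, hj, h⟩ := exists_isReturn_of_lt h2 (by rwa [hl]) (by rwa [hl])
      have hlt := h.lt
      have hright := h.right
      rw [hl] at hright
      have hlast := hr.letter_eq hb hN hz hzl hzp h3 h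
      by_cases hjd : w (j + m) = d
      · exact ⟨j, hlt, hright, by rw [← hlast, h7], hjd⟩
      · have hjc : w (j + m) = c := by
          have h9 := hN j (by omega)
          rw [window_succ] at h9
          rcases hb c d _ hc.right hd.right h9.right hcd with h | h
          · exact h
          · exact absurd h hjd
        have hne : j ≠ i' := fun h => hjd (h ▸ h8)
        obtain ⟨j', hj', h10⟩ := ih j i' (by omega) (by omega) (by omega) (by omega) hright h6
          hjc h8
        exact ⟨j', by omega, h10⟩
  obtain ⟨i, hi, hic⟩ := hc (max N N')
  obtain ⟨i', hi', hid⟩ := hd (i + 1)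
  rw [List.length_append, List.length_singleton, hl, window_succ] at hic hid
  obtain ⟨h1, h2⟩ := List.append_inj' hic rfl
  obtain ⟨h3, h4⟩ := List.append_inj' hid rfl
  obtain ⟨j, hj, h5, h6, h7⟩ := key _ i i' le_rfl (by omega) (by omega) (by omega) h1 h3
    (by simpa using h2) (by simpa using h4)
  refine ⟨j - 1, by omega, ?_⟩
  rw [List.length_cons, List.length_append, List.length_singleton, window_succ', hl,
    Nat.sub_add_cancel (by omega), window_succ, h5, h6, h7]

/-- A return to a bispecial palindrome is a palindrome. -/
theorem reverse_return (hr : BispecialPalindrome w m r) (hb : Binary w) {N : ℕ}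
    (hN : ∀ i ≥ N, Recurs w (window w i (m + 1))) {z : List A} (hz : Recurs w z)
    (hzl : z.length = m + 1) (hzp : z.reverse = z) {i j : ℕ} (hi : N ≤ i)
    (h : IsReturn w r i j) :
    (window w i (j - i + m)).reverse = window w i (j - i + m) := by
  have hl := hr.length
  have hlt := h.lt
  have hlet := hr.letter_eq hb hN hz hzl hzp hi h
  have hleft := h.left
  have hright := h.right
  rw [hl] at hleft hright
  have hstart : ∀ k < m + 1, w (i + k) = w (j + m - 1 - k) := by
    intro k hk
    rcases Nat.lt_or_ge k m with hk' | hk'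
    · have hpal := hr.palindrome
      rw [← hright, reverse_window_eq_iff] at hpal
      rw [window_eq_iff.1 (hleft.trans hright.symm) k hk', ← hpal k hk']
      congr 1
      omega
    · obtain rfl : k = m := by omega
      rw [hlet]
      congr 1
      omega
  have := mirror hr.closed hN (s := 1) (t := j - i) hi (by omega) (by omega) hstart
    (hr.not_rightSpecial h)
  rw [reverse_window_eq_iff]
  intro k hk
  rw [this k (by omega)]
  congr 1
  omega

end BispecialPalindrome

/-! ### Counting recurring words -/

/-- The words of length `n` that occur infinitely often in `w`. -/
def recurrentWords (w : ℕ → A) (n : ℕ) : Set (List A) := {u | u.length = n ∧ Recurs w u}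

/-- The palindromes of length `n` that occur infinitely often in `w`. -/
def recurrentPalindromes (w : ℕ → A) (n : ℕ) : Set (List A) :=
  {u | u.length = n ∧ Recurs w u ∧ u.reverse = u}

theorem finite_recurrentPalindromes [Finite A] (w : ℕ → A) (n : ℕ) :
    (recurrentPalindromes w n).Finite :=
  (finite_length_eq n).subset fun _ h => h.1

theorem finite_factors [Finite A] (w : ℕ → A) (n : ℕ) : (factors w n).Finite :=
  (finite_length_eq n).subset fun _ h => h.1

theorem exists_two_letters [Finite A] {w : ℕ → A} (hb : Binary w)
    (hw : ¬ EventuallyDetermined w) :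
    ∃ a b, a ≠ b ∧ ∀ e, Recurs w [e] ↔ e = a ∨ e = b := by
  obtain ⟨u, hu, a, b, hab, ha, hb'⟩ := exists_rightSpecial hw 0
  rw [List.length_eq_zero_iff] at hu
  subst hu
  refine ⟨a, b, hab, fun e => ⟨fun he => hb _ _ _ ha hb' he hab, ?_⟩⟩
  rintro (rfl | rfl)
  exacts [ha, hb']

theorem RightSpecial.recurs_append {w : ℕ → A} {u : List A} (h : RightSpecial w u)
    (hb : Binary w) {e : A} (he : Recurs w [e]) : Recurs w (u ++ [e]) := by
  obtain ⟨c, d, hcd, hc, hd⟩ := h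
  rcases hb _ _ _ hc.right hd.right he hcd with rfl | rfl
  exacts [hc, hd]

/-- Split by the last letter and use inclusion-exclusion: the words extendable by both letters are
the right special ones. -/
theorem ncard_recurrentWords_succ [Finite A] {w : ℕ → A} (hb : Binary w)
    (hw : ¬ EventuallyDetermined w) (n : ℕ) :
    (recurrentWords w (n + 1)).ncard =
      (recurrentWords w n).ncard + {u : List A | u.length = n ∧ RightSpecial w u}.ncard := by
  obtain ⟨a, b, hab, hlet⟩ := exists_two_letters hb hw
  set E : A → Set (List A) := fun c => {u | u.length = n ∧ Recurs w (u ++ [c])} with hE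
  have hfin : ∀ c, (E c).Finite := fun c => (finite_length_eq n).subset fun _ h => h.1
  have hunion : E a ∪ E b = recurrentWords w n := by
    ext u
    constructor
    · rintro (h | h)
      exacts [⟨h.1, h.2.left⟩, ⟨h.1, h.2.left⟩]
    · rintro ⟨h1, h2⟩
      obtain ⟨c, hc⟩ := h2.exists_append
      rcases (hlet c).1 hc.right with rfl | rfl
      exacts [Or.inl ⟨h1, hc⟩, Or.inr ⟨h1, hc⟩]
  have hinter : E a ∩ E b = {u : List A | u.length = n ∧ RightSpecial w u} := by
    ext u
    constructor
    · rintro ⟨h1, h2⟩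
      exact ⟨h1.1, a, b, hab, h1.2, h2.2⟩
    · rintro ⟨h1, h2⟩
      exact ⟨⟨h1, h2.recurs_append hb ((hlet a).2 (.inl rfl))⟩,
        ⟨h1, h2.recurs_append hb ((hlet b).2 (.inr rfl))⟩⟩
  have hsucc : recurrentWords w (n + 1) =
      (fun u => u ++ [a]) '' E a ∪ (fun u => u ++ [b]) '' E b := by
    ext u
    constructor
    · rintro ⟨h1, h2⟩
      rcases List.eq_nil_or_concat' u with rfl | ⟨v, c, rfl⟩
      · simp at h1
      · have hv : v.length = n := by simpa using h1
        rcases (hlet c).1 h2.right with rfl | rfl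
        exacts [Or.inl ⟨v, ⟨hv, h2⟩, rfl⟩, Or.inr ⟨v, ⟨hv, h2⟩, rfl⟩]
    · rintro (⟨v, hv, rfl⟩ | ⟨v, hv, rfl⟩)
      exacts [⟨by simp [hv.1], hv.2⟩, ⟨by simp [hv.1], hv.2⟩]
  have hdisj : Disjoint ((fun u => u ++ [a]) '' E a) ((fun u => u ++ [b]) '' E b) := by
    rw [Set.disjoint_left]
    rintro _ ⟨u, -, rfl⟩ ⟨v, -, h⟩
    exact hab (by simpa using (List.append_inj' h rfl).2.symm)
  rw [hsucc, Set.ncard_union_eq hdisj ((hfin a).image _) ((hfin b).image _),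
    Set.ncard_image_of_injective _ (List.append_left_injective _),
    Set.ncard_image_of_injective _ (List.append_left_injective _), ← hunion, ← hinter,
    Set.ncard_union_add_ncard_inter _ _ (hfin a) (hfin b)]

theorem eq_of_recurs_cons {w : ℕ → A} {u : List A} (hrev : ReversalClosed w (u.length + 1))
    (h : ¬ RightSpecial w u.reverse) {c d : A}
    (hc : Recurs w (c :: u)) (hd : Recurs w (d :: u)) : c = d := by
  have h1 := hrev _ rfl hc
  have h2 := hrev _ rfl hd
  rw [List.reverse_cons] at h1 h2
  exact eq_of_not_rightSpecial h h1 h2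

/-! ### Induction on the length -/

/-- The recurring blocks of `w` up to length `M` look like those of a Sturmian word. -/
structure SturmianUpTo (w : ℕ → A) (M : ℕ) : Prop where
  closed : ReversalClosed w M
  special : ∀ u v : List A, u.length < M → v.length = u.length →
    RightSpecial w u → RightSpecial w v → v = u
  ncard_palindromes : ∀ k ≤ M, (recurrentPalindromes w k).ncard = if Even k then 1 else 2

theorem SturmianUpTo.bispecialPalindrome {w : ℕ → A} {m : ℕ} (h : SturmianUpTo w (m + 1))
    {r : List A} (hl : r.length = m) (hr : RightSpecial w r) (hr' : RightSpecial w r.reverse) :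
    BispecialPalindrome w m r :=
  ⟨hl, h.special _ _ (by omega) (by simp) hr hr', hr,
    fun _ hu hs => h.special _ _ (by omega) (by omega) hr hs, h.closed⟩

theorem SturmianUpTo.exists_palindrome {w : ℕ → A} {M k : ℕ} (h : SturmianUpTo w M)
    (hk : k ≤ M) : ∃ z, Recurs w z ∧ z.length = k ∧ z.reverse = z := by
  have : (recurrentPalindromes w k).ncard ≠ 0 := by
    rw [h.ncard_palindromes k hk]; split_ifs <;> simp
  obtain ⟨z, h1, h2, h3⟩ := Set.nonempty_of_ncard_ne_zero this
  exact ⟨z, h2, h1, h3⟩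

theorem sturmianUpTo_one [Finite A] {w : ℕ → A} (hb : Binary w)
    (hw : ¬ EventuallyDetermined w) : SturmianUpTo w 1 := by
  obtain ⟨a, b, hab, hlet⟩ := exists_two_letters hb hw
  refine ⟨?_, ?_, ?_⟩
  · intro u hu hr
    obtain ⟨c, rfl⟩ := List.length_eq_one_iff.1 hu
    exact hr
  · intro u v hu hv _ _
    rw [Nat.lt_one_iff] at hu
    rw [hu] at hv
    rw [List.length_eq_zero_iff.1 hu, List.length_eq_zero_iff.1 hv]
  · intro k hk
    interval_cases k
    · have : recurrentPalindromes w 0 = {[]} := by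
        ext u
        simp only [recurrentPalindromes, Set.mem_ofPred_eq, List.length_eq_zero_iff,
          Set.mem_singleton_iff]
        constructor
        · exact fun h => h.1
        · rintro rfl
          exact ⟨rfl, recurs_nil w, rfl⟩
      simp [this]
    · have : recurrentPalindromes w 1 = {[a], [b]} := by
        ext u
        simp only [recurrentPalindromes, Set.mem_ofPred_eq, List.length_eq_one_iff,
          Set.mem_insert_iff, Set.mem_singleton_iff]
        constructor
        · rintro ⟨⟨c, rfl⟩, h, -⟩
          simpa using (hlet c).1 h
        · rintro (rfl | rfl)
          exacts [⟨⟨_, rfl⟩, (hlet _).2 (.inl rfl), rfl⟩, ⟨⟨_, rfl⟩, (hlet _).2 (.inr rfl), rfl⟩]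
      rw [this, Set.ncard_pair (by simpa using hab)]
      simp

theorem exists_eq_cons_append {n : ℕ} {u : List A} (h : u.length = n + 2) :
    ∃ c v d, u = c :: (v ++ [d]) ∧ v.length = n := by
  match u, h with
  | c :: u, h =>
    rcases List.eq_nil_or_concat' u with rfl | ⟨v, d, rfl⟩
    · simp at h
    · exact ⟨c, v, d, rfl, by simpa using h⟩

theorem exists_eq_of_mem_recurrentPalindromes {w : ℕ → A} {n : ℕ} {z : List A}
    (h : z ∈ recurrentPalindromes w (n + 2)) :
    ∃ c q, z = c :: (q ++ [c]) ∧ q ∈ recurrentPalindromes w n := by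
  obtain ⟨h1, h2, h3⟩ := h
  obtain ⟨c, q, d, rfl, hq⟩ := exists_eq_cons_append h1
  simp only [List.reverse_cons, List.reverse_append, List.reverse_nil, List.nil_append,
    List.cons_append, List.cons.injEq] at h3
  obtain ⟨rfl, h4⟩ := h3
  exact ⟨d, q, rfl, hq, h2.tail.left, (List.append_inj' h4 rfl).1⟩

/-- If `q` is right special, the right special word one letter longer must be `d q`, which extends
by `d`. Otherwise reversal closure makes the unique letter after `q` also the unique letter before
it. -/
theorem SturmianUpTo.exists_palindromic_extension [Finite A] {w : ℕ → A} (hb : Binary w)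
    (hw : ¬ EventuallyDetermined w) {m : ℕ} (h : SturmianUpTo w (m + 1)) {q : List A}
    (hq : q ∈ recurrentPalindromes w m) : ∃ c, Recurs w (c :: (q ++ [c])) := by
  obtain ⟨hl, hr, hp⟩ := hq
  by_cases hs : RightSpecial w q
  · obtain ⟨u, hu, hus⟩ := exists_rightSpecial hw (m + 1)
    match u, hu with
    | d :: v, hu =>
      obtain rfl := h.special q v (by omega) (by simp at hu; omega) hs (hus.right (u := [d]))
      exact ⟨d, hus.recurs_append hb (hus.recurs.left (u := [d]))⟩
  · obtain ⟨c, hc⟩ := hr.exists_append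
    obtain ⟨d, hd⟩ := hc.exists_cons
    have h1 := h.closed _ (by simp [hl]) (hd.left (u := d :: q) (v := [c]))
    rw [List.reverse_cons, hp] at h1
    obtain rfl := eq_of_not_rightSpecial hs h1 hc
    exact ⟨d, hd⟩

theorem SturmianUpTo.image_palindromes [Finite A] {w : ℕ → A} (hb : Binary w)
    (hw : ¬ EventuallyDetermined w) {m : ℕ} (h : SturmianUpTo w (m + 1)) :
    (fun z => z.tail.dropLast) '' recurrentPalindromes w (m + 2) = recurrentPalindromes w m := by
  ext q
  constructor
  · rintro ⟨z, hz, rfl⟩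
    obtain ⟨c, q, rfl, hq⟩ := exists_eq_of_mem_recurrentPalindromes hz
    simpa using hq
  · intro hq
    obtain ⟨c, hc⟩ := h.exists_palindromic_extension hb hw hq
    exact ⟨c :: (q ++ [c]), ⟨by simp [hq.1], hc, by simp [hq.2.2]⟩, by simp⟩

/-- Stripping the two end letters is onto, but identifies `c r c` with `d r d`. -/
theorem SturmianUpTo.ncard_palindromes_lt [Finite A] {w : ℕ → A} (hb : Binary w)
    (hw : ¬ EventuallyDetermined w) {m : ℕ} (h : SturmianUpTo w (m + 1)) {r : List A}
    (hr : r ∈ recurrentPalindromes w m) {c d : A} (hcd : c ≠ d)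
    (hc : Recurs w (c :: (r ++ [c]))) (hd : Recurs w (d :: (r ++ [d]))) :
    (recurrentPalindromes w m).ncard < (recurrentPalindromes w (m + 2)).ncard := by
  have hfin := finite_recurrentPalindromes w (m + 2)
  rw [← h.image_palindromes hb hw]
  refine lt_of_le_of_ne (Set.ncard_image_le hfin) fun heq => hcd ?_
  have hinj := (Set.ncard_image_iff hfin).1 heq
  have h1 : c :: (r ++ [c]) ∈ recurrentPalindromes w (m + 2) :=
    ⟨by simp [hr.1], hc, by simp [hr.2.2]⟩
  have h2 : d :: (r ++ [d]) ∈ recurrentPalindromes w (m + 2) :=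
    ⟨by simp [hr.1], hd, by simp [hr.2.2]⟩
  have := hinj h1 h2 (by simp)
  exact (List.cons.inj this).1

/-- If no bispecial palindrome has two palindromic extensions, the Sturmian structure propagates
to the next length. -/
theorem SturmianUpTo.step [Finite A] {w : ℕ → A} (hb : Binary w)
    (hw : ¬ EventuallyDetermined w) {m : ℕ} (h : SturmianUpTo w (m + 1))
    (hone : ∀ r c d, BispecialPalindrome w m r → Recurs w (c :: (r ++ [c])) →
      Recurs w (d :: (r ++ [d])) → c = d) : SturmianUpTo w (m + 2) := by
  refine ⟨?_, ?_, ?_⟩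
  · intro u hu hr
    obtain ⟨x, v, y, rfl, hv⟩ := exists_eq_cons_append hu
    have hxv : Recurs w (v.reverse ++ [x]) := by
      simpa using h.closed _ (by simp [hv]) (hr.left (u := x :: v))
    have hvy : Recurs w (y :: v.reverse) := by
      simpa using h.closed _ (by simp [hv]) hr.tail
    suffices Recurs w (y :: (v.reverse ++ [x])) by simpa using this
    -- If `v` or its reverse is not right special, a unique extension forces the reversed word;
    -- otherwise `v` is a bispecial palindrome and its mixed extensions recur.
    by_cases h1 : RightSpecial w v
    · by_cases h2 : RightSpecial w v.reverse
      · have hbi := h.bispecialPalindrome hv h1 h2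
        rw [hbi.palindrome] at hxv ⊢
        by_cases hxy : x = y
        · subst hxy
          exact hr
        · obtain ⟨z, hz1, hz2, hz3⟩ := h.exists_palindrome le_rfl
          exact hbi.recurs_mixed hb hz1 hz2 hz3 (Ne.symm hxy) hr.tail hxv
      · obtain ⟨c, hc⟩ := hvy.exists_append
        obtain rfl := eq_of_not_rightSpecial h2 hc.tail hxv
        exact hc
    · obtain ⟨c, hc⟩ := hxv.exists_cons
      have : ReversalClosed w (v.reverse.length + 1) := by
        rw [List.length_reverse, hv]; exact h.closed
      obtain rfl := eq_of_recurs_cons this (by rwa [List.reverse_reverse])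
        (hc.left (u := c :: v.reverse)) hvy
      exact hc
  · intro u v hu hv hus hvs
    rcases Nat.lt_or_ge u.length (m + 1) with hlt | hge
    · exact h.special u v hlt hv hus hvs
    · match u, v with
      | [], _ => simp at hge
      | _ :: _, [] => simp at hv
      | c :: r, d :: r' =>
        have hrl : r.length = m := by simp at hu hge; omega
        obtain rfl := h.special r r' (by omega) (by simpa using hv) (hus.right (u := [c]))
          (hvs.right (u := [d]))
        by_contra hne
        have hcd : c ≠ d := fun h => hne (by rw [h])
        have hrs := hus.right (u := [c])
        have hcr := h.closed _ (by simp [hrl]) hus.recurs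
        have hdr := h.closed _ (by simp [hrl]) hvs.recurs
        rw [List.reverse_cons] at hcr hdr
        refine hcd (hone _ c d (h.bispecialPalindrome hrl hrs ⟨c, d, hcd, hcr, hdr⟩) ?_ ?_)
        exacts [hus.recurs_append hb hcr.right, hvs.recurs_append hb hdr.right]
  · intro k hk
    rcases Nat.lt_or_ge k (m + 2) with hlt | hge
    · exact h.ncard_palindromes k (by omega)
    · obtain rfl : k = m + 2 := by omega
      have hinj : Set.InjOn (fun z : List A => z.tail.dropLast)
          (recurrentPalindromes w (m + 2)) := by
        intro z hz z' hz' heq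
        obtain ⟨c, q, rfl, hq⟩ := exists_eq_of_mem_recurrentPalindromes hz
        obtain ⟨d, q', rfl, hq'⟩ := exists_eq_of_mem_recurrentPalindromes hz'
        obtain rfl : q = q' := by simpa using heq
        by_cases hcd : c = d
        · rw [hcd]
        · have hs : RightSpecial w q := ⟨c, d, hcd, hz.2.1.tail, hz'.2.1.tail⟩
          exact absurd (hone q c d (h.bispecialPalindrome hq.1 hs (by rwa [hq.2.2]))
            hz.2.1 hz'.2.1) hcd
      rw [← hinj.ncard_image, h.image_palindromes hb hw,
        h.ncard_palindromes m (by omega)]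
      simp [Nat.even_add]

/-! ### Recurring privileged words are the recurring palindromes -/

/-- A word that returns inside a recurring word has a right special continuation. -/
theorem exists_rightSpecial_append [Finite A] {w : ℕ → A} (hw : ¬ EventuallyDetermined w)
    {u v : List A} (hv : Recurs w v) (hlt : u.length < v.length) (hpre : u <+: v)
    (hsuf : u <:+ v) : ∃ x, RightSpecial w (u ++ x) := by
  by_contra! hno
  apply hw
  have key : ∀ n, ∀ x y : List A, x.length = n → y.length = n → Recurs w (u ++ x) →
      Recurs w (u ++ y) → x = y := by
    intro n
    induction n with
    | zero =>
      intro x y hx hy _ _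
      rw [List.length_eq_zero_iff.1 hx, List.length_eq_zero_iff.1 hy]
    | succ n ih =>
      intro x y hx hy hxr hyr
      rcases List.eq_nil_or_concat' x with rfl | ⟨x, c, rfl⟩
      · simp at hx
      rcases List.eq_nil_or_concat' y with rfl | ⟨y, d, rfl⟩
      · simp at hy
      rw [← List.append_assoc] at hxr hyr
      obtain rfl := ih x y (by simpa using hx) (by simpa using hy) hxr.left hyr.left
      rw [eq_of_not_rightSpecial (hno x) hxr hyr]
  obtain ⟨x, rfl⟩ := hpre
  -- With unique continuations, each late occurrence of `u` is followed by `x`, hence by another `u`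
  -- at distance `g`; so `g` is an eventual period.
  obtain ⟨g, hg⟩ : ∃ g, g = x.length := ⟨_, rfl⟩
  have hg0 : 0 < g := by simp at hlt; omega
  obtain ⟨N, hN⟩ := eventually_recurs_window w (u.length + g)
  have hdet : ∀ i ≥ N, window w i u.length = u → window w i (u.length + g) = u ++ x := by
    intro i hi hu
    have := hN i hi
    rw [window_add, hu] at this ⊢
    rw [key g _ x (by simp) hg.symm this hv]
  have hnext : ∀ i ≥ N, window w i u.length = u → window w (i + g) u.length = u := by
    intro i hi hu
    rw [← hdet i hi hu, suffix_window_iff, Nat.add_sub_cancel_left] at hsuf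
    exact hsuf.2
  obtain ⟨i, hi, hu⟩ := hv.left N
  have hall : ∀ s, window w (i + s * g) u.length = u := by
    intro s
    induction s with
    | zero => simpa using hu
    | succ s ih =>
      have := hnext _ (by omega) ih
      rwa [add_assoc, ← Nat.succ_mul] at this
  refine eventuallyDetermined_of_period (i := i) (i' := i + g) (by omega) fun k => ?_
  have h1 := hdet _ (by omega) (hall (k / g))
  have h2 := hdet _ (by omega) (hall (k / g + 1))
  have hmod := Nat.mod_lt k hg0
  have := window_eq_iff.1 (h1.trans h2.symm) (k % g) (by omega)
  have hk := Nat.div_add_mod' k g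
  rwa [show i + k / g * g + k % g = i + k by omega,
    show i + (k / g + 1) * g + k % g = i + g + k by rw [Nat.add_mul]; omega] at this

theorem Recurs.of_prefix {w : ℕ → A} {u v : List A} (h : Recurs w v) (hu : u <+: v) :
    Recurs w u := by
  obtain ⟨x, rfl⟩ := hu
  exact h.left

theorem Recurs.of_suffix {w : ℕ → A} {u v : List A} (h : Recurs w v) (hu : u <:+ v) :
    Recurs w u := by
  obtain ⟨x, rfl⟩ := hu
  exact h.right

theorem window_eq_cons_append {w : ℕ → A} {i : ℕ} {c d : A} {v : List A} :
    window w i (c :: v ++ [d]).length = c :: v ++ [d] ↔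
      w i = c ∧ window w (i + 1) v.length = v ∧ w (i + 1 + v.length) = d := by
  have : (c :: v ++ [d]).length = v.length + 1 + 1 := by simp
  rw [this, window_succ', window_succ, List.cons_append, List.cons.injEq]
  refine and_congr_right fun _ => ⟨fun h => ?_, fun h => ?_⟩
  · obtain ⟨h1, h2⟩ := List.append_inj' h rfl
    exact ⟨h1, by simpa using h2⟩
  · rw [h.1, h.2]

theorem SturmianUpTo.reverse_eq_of_rightSpecial [Finite A] {w : ℕ → A} (hb : Binary w)
    {u v : List A} (h : SturmianUpTo w (u.length + 1)) (hs : RightSpecial w u)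
    (hu : u.reverse = u) (hv : Recurs w v) (hlt : u.length < v.length)
    (hret : IsCompleteFirstReturn v u) : v.reverse = v := by
  have hbi := h.bispecialPalindrome rfl hs (by rwa [hu])
  obtain ⟨N, hN⟩ := eventually_recurs_window w (u.length + 1)
  obtain ⟨z, hz1, hz2, hz3⟩ := h.exists_palindrome le_rfl
  obtain ⟨i, hi, hiv⟩ := hv N
  rw [← hiv] at hret
  have := hbi.reverse_return hb hN hz1 hz2 hz3 hi (hret.isReturn hlt)
  rwa [Nat.add_sub_cancel_left, Nat.sub_add_cancel hlt.le, hiv] at this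

/-- A recurring complete first return to a recurring palindrome is a palindrome. -/
theorem reverse_eq_of_isCompleteFirstReturn_of_rightSpecial [Finite A] {w : ℕ → A}
    (hb : Binary w) (h : ∀ M, SturmianUpTo w M) {x u v : List A} (hx : RightSpecial w (u ++ x))
    (hu : u.reverse = u) (hv : Recurs w v) (hlt : u.length < v.length)
    (hret : IsCompleteFirstReturn v u) : v.reverse = v := by
  induction x generalizing u v with
  | nil =>
    rw [List.append_nil] at hx
    exact (h _).reverse_eq_of_rightSpecial hb hx hu hv hlt hret
  | cons c x ih =>
    by_cases hs : RightSpecial w u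
    · exact (h _).reverse_eq_of_rightSpecial hb hs hu hv hlt hret
    have huc : Recurs w (u ++ [c]) := by
      have := hx.recurs
      rw [List.append_cons] at this
      exact this.left
    have hright : ∀ e, Recurs w (u ++ [e]) → e = c := fun e he =>
      eq_of_not_rightSpecial hs he huc
    have hleft : ∀ e, Recurs w (e :: u) → e = c := fun e he =>
      hright e (by simpa [hu] using (h (u.length + 1)).closed _ rfl he)
    -- The forced letter surrounds every `u`, so `v` can be replaced by `c v c`, a complete first
    -- return to `c u c`. This shortens the distance `x` to a right special word.
    obtain ⟨e, he⟩ := hv.exists_cons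
    obtain rfl := hleft e (he.of_prefix (by simpa using hret.1))
    obtain ⟨f, hf⟩ := he.exists_append
    obtain rfl := hright f (hf.tail.of_suffix (by
      obtain ⟨y, hy⟩ := hret.2.1
      exact ⟨y, by rw [← List.append_assoc, hy]; rfl⟩))
    have hspecial : RightSpecial w (f :: u ++ [f] ++ x) := by
      obtain ⟨a, b, hab, ha, hb'⟩ := hx
      have : ∀ a, Recurs w (u ++ f :: x ++ [a]) → Recurs w (f :: u ++ [f] ++ x ++ [a]) := by
        intro a ha
        obtain ⟨g, hg⟩ := ha.exists_cons
        obtain rfl := hleft g (hg.of_prefix (by simp))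
        simpa using hg
      exact ⟨a, b, hab, this a ha, this b hb'⟩
    obtain ⟨i, -, hi⟩ := hf 0
    obtain ⟨h1, h3, h4⟩ := window_eq_cons_append.1 hi
    have hret' := hret
    rw [← h3] at hret'
    have hr := hret'.isReturn hlt
    have hlong : IsReturn w (f :: u ++ [f]) i (i + (v.length - u.length)) := by
      refine ⟨by omega, window_eq_cons_append.2 ⟨h1, hr.left, ?_⟩,
        window_eq_cons_append.2 ⟨?_, ?_, ?_⟩, fun y h5 h6 h7 => ?_⟩
      · refine hright _ (hv.of_prefix ?_)
        rw [← h3, prefix_window_iff, List.length_append, List.length_singleton, window_succ,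
          hr.left]
        exact ⟨hlt, rfl⟩
      · refine hleft _ (he.of_suffix ?_)
        have h6 : f :: v = window w i (v.length + 1) := by rw [window_succ', h1, h3]
        rw [h6, suffix_window_iff, List.length_cons, window_succ', Nat.add_sub_add_right]
        refine ⟨by omega, ?_⟩
        rw [add_right_comm, hr.right]
      · rw [add_right_comm]; exact hr.right
      · rw [show i + (v.length - u.length) + 1 + u.length = i + 1 + v.length by omega, h4]
      · exact hr.between (y + 1) (by omega) (by omega) (window_eq_cons_append.1 h7).2.1
    have := hlong.isCompleteFirstReturn
    rw [show i + (v.length - u.length) - i + (f :: u ++ [f]).length =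
      (f :: v ++ [f]).length by simp; omega, hi] at this
    have := ih hspecial (by simp [hu]) hf (by simpa using hlt) this
    simpa using this

/-- Recurring palindromes are privileged as soon as the shorter recurring privileged words are
palindromes and conversely. -/
theorem isPrivileged_of_palindrome {w : ℕ → A} {z : List A}
    (ih : ∀ u : List A, u.length < z.length → Recurs w u → (IsPrivileged u ↔ u.reverse = u))
    (hz : Recurs w z) (hp : z.reverse = z) : IsPrivileged z := by
  obtain ⟨n, hn⟩ : ∃ n, n = z.length := ⟨_, rfl⟩
  obtain ⟨i, -, hi⟩ := hz 0
  rw [← hn] at ih hi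
  match n with
  | 0 => rw [List.length_eq_zero_iff.1 hn.symm]; exact .nil
  | n + 1 =>
    set P : ℕ → Prop := fun l =>
      (window w (i + (n + 1 - l)) l).reverse = window w (i + (n + 1 - l)) l
    classical
    have hP0 : P 0 := rfl
    -- `y` will be the longest proper palindromic suffix of `z`. A return to `y` closing `z` but
    -- starting inside it would be a longer one.
    set l := Nat.findGreatest P n with hl
    have hPl : P l := Nat.findGreatest_spec (Nat.zero_le n) hP0
    have hln : l ≤ n := Nat.findGreatest_le n
    set y := window w (i + (n + 1 - l)) l with hy
    have hsuf : ∀ k ≤ n + 1, Recurs w (window w (i + (n + 1 - k)) k) := by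
      intro k hk
      refine hz.of_suffix ?_
      rw [← hi, suffix_window_iff]
      simp [hk]
    have hyr : Recurs w y := hsuf l (by omega)
    have hyp : IsPrivileged y := (ih y (by simp [hy]; omega) hyr).2 hPl
    have hylen : y.length = l := by simp [hy]
    have hpre : window w i y.length = y := by
      have : y.reverse <+: window w i (n + 1) := by
        rw [hi, ← hp, List.reverse_prefix, ← hi, suffix_window_iff, hylen]
        exact ⟨by omega, rfl⟩
      rw [hPl, prefix_window_iff] at this
      exact this.2
    obtain ⟨i', hi', hret⟩ := exists_isReturn_of_gt (show i < i + (n + 1 - l) by omega) hpre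
      (by rw [hylen])
    have hlt := hret.lt
    have hpriv := hret.isPrivileged hyp
    rw [hylen] at hpriv
    rcases Nat.eq_or_lt_of_le hi' with rfl | hlt'
    · rwa [show i + (n + 1 - l) - i + l = n + 1 by omega, hi] at hpriv
    · exfalso
      obtain ⟨k, hk⟩ : ∃ k, k = i + (n + 1 - l) - i' + l := ⟨_, rfl⟩
      rw [← hk, show i' = i + (n + 1 - k) by omega] at hpriv
      have := (ih _ (by simp; omega) (hsuf k (by omega))).1 hpriv
      exact Nat.findGreatest_is_greatest (P := P) (n := n) (k := k) (by omega) (by omega) this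

theorem isPrivileged_iff_reverse_eq [Finite A] {w : ℕ → A}
    (hb : Binary w) (hw : ¬ EventuallyDetermined w) (h : ∀ M, SturmianUpTo w M) {u : List A}
    (hu : Recurs w u) : IsPrivileged u ↔ u.reverse = u := by
  induction hn : u.length using Nat.strong_induction_on generalizing u with
  | _ n ih =>
    subst hn
    refine ⟨fun hp => ?_, isPrivileged_of_palindrome (fun v hv hr => ih _ hv hr rfl) hu⟩
    cases hp with
    | nil => rfl
    | letter a => rfl
    | completeReturn _ v h2 hlt hv hret =>
      obtain ⟨x, hx⟩ := exists_rightSpecial_append hw hu hlt hret.1 hret.2.1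
      exact reverse_eq_of_isCompleteFirstReturn_of_rightSpecial hb h hx
        ((ih _ hlt (hu.of_prefix hret.1) rfl).1 hv) hu hlt hret

/-! ### Bounding the number of privileged factors -/

/-- A privileged prefix of a privileged word is also a suffix. -/
theorem IsPrivileged.suffix_of_prefix {u v : List A} (hv : IsPrivileged v) (hu : IsPrivileged u)
    (h : u <+: v) : u <:+ v := by
  induction hn : v.length using Nat.strong_induction_on generalizing u v with
  | _ n ih =>
    subst hn
    rcases Nat.eq_or_lt_of_le h.length_le with heq | hlt
    · rw [h.eq_of_length heq]
    cases hv with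
    | nil => simp at hlt
    | letter a =>
      rw [List.length_singleton, Nat.lt_one_iff, List.length_eq_zero_iff] at hlt
      rw [hlt]
      exact List.nil_suffix
    | completeReturn _ x h2 hxv hx hret =>
      rcases Nat.lt_or_ge x.length u.length with h3 | h3
      · exfalso
        have h4 := ih _ hlt hu hx (List.prefix_of_prefix_length_le hret.1 h h3.le) rfl
        obtain ⟨y, rfl⟩ := h4
        obtain ⟨s, hs⟩ := h
        obtain ⟨t, ht⟩ := hret.2.1
        rw [List.length_append] at h3 hlt
        have hlen := congrArg List.length ht
        rw [List.length_append] at hlen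
        have hsub : ({0, y.length, t.length} : Set ℕ) ⊆ occurrences x v := by
          rintro p (rfl | rfl | rfl)
          · exact ⟨by omega, by simpa using hret.1⟩
          · refine ⟨by omega, ?_⟩
            rw [← hs]
            simp
          · refine ⟨by omega, ?_⟩
            rw [← ht]
            simp
        have hfin : (occurrences x v).Finite :=
          Set.finite_of_ncard_ne_zero (by rw [hret.2.2]; omega)
        have := Set.ncard_le_ncard hsub hfin
        rw [hret.2.2, Set.ncard_eq_three.2 ⟨0, y.length, t.length, by omega, by omega,
          by omega, rfl⟩] at this
        omega
      · exact (ih _ hxv hx hu (List.prefix_of_prefix_length_le h hret.1 h3) rfl).trans hret.2.1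

/-- A prefix of length `N` has at most `N + 1` privileged factors. -/
theorem ncard_privileged_le (w : ℕ → A) (N : ℕ) {S : Set (List A)}
    (hS : ∀ u ∈ S, IsPrivileged u ∧ ∃ i, i + u.length ≤ N ∧ window w i u.length = u) :
    S.Finite ∧ S.ncard ≤ N + 1 := by
  classical
  set P : List A → ℕ → Prop := fun u i => i + u.length ≤ N ∧ window w i u.length = u
  set f : List A → ℕ := fun u => Nat.findGreatest (P u) N
  have hf : ∀ u ∈ S, P u (f u) := by
    intro u hu
    obtain ⟨i, hi⟩ := (hS u hu).2
    exact Nat.findGreatest_spec (P := P u) (m := i) (by omega) hi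
  have hmax : ∀ u i, f u < i → ¬ P u i := by
    intro u i hi hP
    exact Nat.findGreatest_is_greatest hi (by have := hP.1; omega) hP
  have hpre : ∀ u ∈ S, ∀ v ∈ S, f u = f v → u.length ≤ v.length → u = v := by
    intro u hu v hv heq hle
    have h1 := hf u hu
    have h2 := hf v hv
    have h3 : u <+: v := by
      rw [← h2.2, prefix_window_iff, ← heq]
      exact ⟨hle, h1.2⟩
    rcases Nat.eq_or_lt_of_le hle with h | h
    · exact h3.eq_of_length h
    · exfalso
      have h4 := (hS v hv).1.suffix_of_prefix (hS u hu).1 h3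
      rw [← h2.2, suffix_window_iff] at h4
      have := h2.1
      exact hmax u (f v + (v.length - u.length)) (by omega) ⟨by omega, h4.2⟩
  have hinj : Set.InjOn f S := by
    intro u hu v hv heq
    rcases le_total u.length v.length with h | h
    · exact hpre u hu v hv heq h
    · exact (hpre v hv u hu heq.symm h).symm
  have hmaps : Set.MapsTo f S (Finset.range (N + 1) : Set ℕ) := by
    intro u hu
    have := (hf u hu).1
    simp only [Finset.coe_range, Set.mem_Iio]
    omega
  refine ⟨Set.Finite.of_injOn hmaps hinj (Finset.finite_toSet _), ?_⟩
  have := Set.ncard_le_ncard_of_injOn f hmaps hinj (Finset.finite_toSet _)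
  rwa [Set.ncard_coe_finset, Finset.card_range] at this

/-- If a block does not occur again after position `i`, neither does some privileged block
starting there. -/
theorem exists_isPrivileged_last {w : ℕ → A} {i n : ℕ}
    (h : ∀ j > i, window w j n ≠ window w i n) :
    ∃ y, IsPrivileged y ∧ window w i y.length = y ∧ ∀ j > i, window w j y.length ≠ y := by
  by_contra! hno
  -- If every privileged block at `i` came back, complete first returns would give ever longer
  -- privileged blocks there.
  have key : ∀ k, ∃ y, IsPrivileged y ∧ window w i y.length = y ∧ k ≤ y.length := by
    intro k
    induction k with
    | zero => exact ⟨[], .nil, rfl, le_rfl⟩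
    | succ k ih =>
      obtain ⟨y, h1, h2, h3⟩ := ih
      obtain ⟨j, hj, hy⟩ := hno y h1 h2
      obtain ⟨j', -, hret⟩ := exists_isReturn_of_lt hj h2 hy
      have := hret.lt
      exact ⟨_, hret.isPrivileged h1, by simp, by simp; omega⟩
  obtain ⟨y, h1, h2, h3⟩ := key n
  obtain ⟨j, hj, hy⟩ := hno y h1 h2
  refine h j hj ?_
  rw [← window_take w j _ n h3, ← window_take w i _ n h3, hy, h2]

/-! ### From Sturmian to privileged complexity -/

theorem IsSturmian.not_eventuallyDetermined [Finite A] {w : ℕ → A} (h : IsSturmian w) :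
    ¬ EventuallyDetermined w := by
  intro hw
  obtain ⟨B, hB⟩ := hw.exists_bound
  have hsub : factors w B ⊆ (fun i => window w i B) '' (Finset.range B : Set ℕ) := by
    intro u hu
    obtain ⟨i, rfl⟩ := mem_factors_iff.1 hu
    obtain ⟨i', h1, h2⟩ := hB B i
    exact ⟨i', by simpa using h1, h2⟩
  have h1 := Set.ncard_le_ncard hsub ((Finset.finite_toSet _).image _)
  have h2 := h1.trans (Set.ncard_image_le (Finset.finite_toSet _))
  rw [Set.ncard_coe_finset, Finset.card_range] at h2
  have := h B
  unfold factorComplexity at this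
  omega

theorem recurrentWords_subset_factors (w : ℕ → A) (n : ℕ) :
    recurrentWords w n ⊆ factors w n :=
  fun _ h => ⟨h.1, h.2.isFactor⟩

theorem ncard_recurrentWords_zero (w : ℕ → A) : (recurrentWords w 0).ncard = 1 := by
  have : recurrentWords w 0 = {[]} := by
    ext u
    simp only [recurrentWords, Set.mem_ofPred_eq, List.length_eq_zero_iff, Set.mem_singleton_iff]
    constructor
    · exact fun h => h.1
    · rintro rfl
      exact ⟨rfl, recurs_nil w⟩
  simp [this]

theorem finite_rightSpecial [Finite A] (w : ℕ → A) (n : ℕ) :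
    {u : List A | u.length = n ∧ RightSpecial w u}.Finite :=
  (finite_length_eq n).subset fun _ h => h.1

theorem lt_ncard_recurrentWords [Finite A] {w : ℕ → A} (hb : Binary w)
    (hw : ¬ EventuallyDetermined w) (n : ℕ) : n < (recurrentWords w n).ncard := by
  induction n with
  | zero => simp [ncard_recurrentWords_zero]
  | succ n ih =>
    have := (Set.ncard_pos (finite_rightSpecial w n)).2 (exists_rightSpecial hw n)
    rw [ncard_recurrentWords_succ hb hw]
    omega

theorem IsSturmian.binary [Finite A] {w : ℕ → A} (h : IsSturmian w) : Binary w :=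
  binary_of_ncard_factors (h 1)

/-- The recurring words already number at least `n + 1`, leaving no room for other factors. -/
theorem IsSturmian.factors_eq [Finite A] {w : ℕ → A} (h : IsSturmian w) (n : ℕ) :
    factors w n = recurrentWords w n := by
  refine (Set.eq_of_subset_of_ncard_le (recurrentWords_subset_factors w n) ?_
    (finite_factors w n)).symm
  have h1 := lt_ncard_recurrentWords h.binary h.not_eventuallyDetermined n
  have h2 := h n
  unfold factorComplexity at h2
  omega

theorem IsSturmian.sturmianUpTo [Finite A] {w : ℕ → A} (h : IsSturmian w) (m : ℕ) :
    SturmianUpTo w (m + 1) := by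
  have hb := h.binary
  have hw := h.not_eventuallyDetermined
  induction m with
  | zero => exact sturmianUpTo_one hb hw
  | succ m ih =>
    refine ih.step hb hw fun r c d hr hc hd => ?_
    by_contra hcd
    obtain ⟨z, hz1, hz2, hz3⟩ := ih.exists_palindrome le_rfl
    have hcm := hr.recurs_mixed hb hz1 hz2 hz3 hcd hc.tail hd.tail
    have hdm := hr.recurs_mixed hb hz1 hz2 hz3 (Ne.symm hcd) hd.tail hc.tail
    have hsub : ({c :: r, d :: r} : Set (List A)) ⊆
        {u : List A | u.length = m + 1 ∧ RightSpecial w u} := by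
      rintro u (rfl | rfl)
      exacts [⟨by simp [hr.length], c, d, hcd, hc, hcm⟩, ⟨by simp [hr.length], c, d, hcd, hdm, hd⟩]
    have h1 := Set.ncard_le_ncard hsub (finite_rightSpecial w _)
    rw [Set.ncard_pair (by simpa using hcd)] at h1
    have h2 := ncard_recurrentWords_succ hb hw (m + 1)
    rw [← h.factors_eq, ← h.factors_eq] at h2
    have h3 := h (m + 1)
    have h4 := h (m + 1 + 1)
    unfold factorComplexity at h3 h4
    omega

theorem SturmianUpTo.mono [Finite A] {w : ℕ → A} {M N : ℕ} (h : SturmianUpTo w N)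
    (hMN : M ≤ N) : SturmianUpTo w M :=
  ⟨h.closed.mono hMN, fun u v hu => h.special u v (by omega),
    fun k hk => h.ncard_palindromes k (by omega)⟩

theorem IsSturmian.privilegedComplexity_eq [Finite A] {w : ℕ → A} (h : IsSturmian w) (n : ℕ) :
    privilegedComplexity w n = if Even n then 1 else 2 := by
  have hall : ∀ M, SturmianUpTo w M := fun M => (h.sturmianUpTo M).mono (Nat.le_succ M)
  rw [← (hall n).ncard_palindromes n le_rfl]
  unfold privilegedComplexity
  congr 1
  ext u
  rw [h.factors_eq]
  simp only [recurrentWords, recurrentPalindromes, Set.mem_ofPred_eq, and_assoc]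
  exact and_congr_right fun _ => and_congr_right fun hr =>
    isPrivileged_iff_reverse_eq h.binary h.not_eventuallyDetermined hall hr

/-! ### From privileged complexity to Sturmian -/

/-- The privileged factors of `w` of length `n`. -/
def privilegedFactors (w : ℕ → A) (n : ℕ) : Set (List A) :=
  {u | u ∈ factors w n ∧ IsPrivileged u}

theorem finite_privilegedFactors [Finite A] (w : ℕ → A) (n : ℕ) :
    (privilegedFactors w n).Finite :=
  (finite_factors w n).subset fun _ h => h.1

/-- Under eventual periodicity, the privileged factors shorter than `n` all fit in a prefix of
length `B + n`, so number at most `B + n + 1`. The hypothesis makes them grow like `3 n / 2`. -/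
theorem not_eventuallyDetermined_of_ncard [Finite A] {w : ℕ → A}
    (h : ∀ n, (privilegedFactors w n).ncard = if Even n then 1 else 2) :
    ¬ EventuallyDetermined w := by
  intro hw
  obtain ⟨B, hB⟩ := hw.exists_bound
  set U : ℕ → Set (List A) := fun n => {u | u.length < n ∧ IsFactor u w ∧ IsPrivileged u} with hU
  have hbound : ∀ n, (U n).Finite ∧ (U n).ncard ≤ B + n + 1 := by
    intro n
    refine ncard_privileged_le w (B + n) fun u hu => ⟨hu.2.2, ?_⟩
    obtain ⟨i, hi⟩ := isFactor_iff.1 hu.2.1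
    obtain ⟨i', h1, h2⟩ := hB u.length i
    have := hu.1
    exact ⟨i', by omega, h2.trans hi⟩
  have hsucc : ∀ n, (U (n + 1)).ncard = (U n).ncard + if Even n then 1 else 2 := by
    intro n
    have hun : U (n + 1) = U n ∪ privilegedFactors w n := by
      ext u
      simp only [hU, privilegedFactors, factors, Set.mem_union, Set.mem_ofPred_eq]
      constructor
      · rintro ⟨h1, h2, h3⟩
        rcases Nat.lt_succ_iff_lt_or_eq.1 h1 with h4 | h4
        exacts [Or.inl ⟨h4, h2, h3⟩, Or.inr ⟨⟨h4, h2⟩, h3⟩]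
      · rintro (⟨h1, h2⟩ | ⟨⟨h1, h2⟩, h3⟩)
        exacts [⟨by omega, h2⟩, ⟨by omega, h2, h3⟩]
    have hdisj : Disjoint (U n) (privilegedFactors w n) := by
      rw [Set.disjoint_left]
      intro u h1 h2
      exact h1.1.ne h2.1.1
    rw [hun, Set.ncard_union_eq hdisj (hbound n).1 (finite_privilegedFactors w n), h n]
  have hcount : ∀ m, 3 * m ≤ (U (2 * m)).ncard := by
    intro m
    induction m with
    | zero => simp
    | succ m ih =>
      rw [show 2 * (m + 1) = 2 * m + 1 + 1 by ring, hsucc, hsucc]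
      simp only [even_two, Even.mul_right, if_true, Nat.even_add_one, not_true_eq_false, if_false]
      omega
  have h1 := hcount (B + 2)
  have h2 := (hbound (2 * (B + 2))).2
  omega

theorem binary_of_ncard [Finite A] {w : ℕ → A}
    (h : ∀ n, (privilegedFactors w n).ncard = if Even n then 1 else 2) : Binary w := by
  apply binary_of_ncard_factors
  have : privilegedFactors w 1 = factors w 1 := by
    ext u
    refine ⟨fun hu => hu.1, fun hu => ⟨hu, ?_⟩⟩
    obtain ⟨c, rfl⟩ := List.length_eq_one_iff.1 hu.1
    exact .letter c
  rw [← this, h 1]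
  simp

theorem sturmianUpTo_of_ncard [Finite A] {w : ℕ → A}
    (h : ∀ n, (privilegedFactors w n).ncard = if Even n then 1 else 2) (m : ℕ) :
    SturmianUpTo w (m + 1) ∧ ∀ n ≤ m + 1, recurrentPalindromes w n = privilegedFactors w n := by
  have hb := binary_of_ncard h
  have hw := not_eventuallyDetermined_of_ncard h
  have heq : ∀ M, SturmianUpTo w M → ∀ n ≤ M,
      recurrentPalindromes w n ⊆ privilegedFactors w n →
      recurrentPalindromes w n = privilegedFactors w n := by
    intro M hM n hn hsub
    exact Set.eq_of_subset_of_ncard_le hsub (by rw [h, hM.ncard_palindromes n hn])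
      (finite_privilegedFactors w n)
  induction m with
  | zero =>
    have h1 := sturmianUpTo_one hb hw
    refine ⟨h1, fun n hn => heq 1 h1 n hn fun u hu => ⟨⟨hu.1, hu.2.1.isFactor⟩, ?_⟩⟩
    match u, hu.1 with
    | [], _ => exact .nil
    | [c], _ => exact .letter c
    | _ :: _ :: _, hl => simp at hl; omega
  | succ m ih =>
    obtain ⟨hS, hpal⟩ := ih
    have hsub : recurrentPalindromes w (m + 2) ⊆ privilegedFactors w (m + 2) := by
      intro z hz
      refine ⟨⟨hz.1, hz.2.1.isFactor⟩, isPrivileged_of_palindrome (fun u hu hr => ?_) hz.2.1 hz.2.2⟩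
      have := Set.ext_iff.1 (hpal u.length (by have := hz.1; omega)) u
      constructor
      · exact fun hp => (this.2 ⟨⟨rfl, hr.isFactor⟩, hp⟩).2.2
      · exact fun hp => (this.1 ⟨rfl, hr, hp⟩).2
    have hS' : SturmianUpTo w (m + 2) := by
      refine hS.step hb hw fun r c d hr hc hd => ?_
      by_contra hcd
      -- Palindromes of length `m + 2` would outnumber those of length `m`, although they are
      -- privileged and the prescribed count depends only on parity.
      have h1 := hS.ncard_palindromes_lt hb hw ⟨hr.length, hr.special.recurs, hr.palindrome⟩
        hcd hc hd
      have h2 := Set.ncard_le_ncard hsub (finite_privilegedFactors w _)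
      rw [hS.ncard_palindromes m (by omega)] at h1
      rw [h] at h2
      simp only [Nat.even_add, even_two, iff_true] at h2
      omega
    refine ⟨hS', fun n hn => ?_⟩
    rcases Nat.lt_or_ge n (m + 2) with h1 | h1
    · exact hpal n (by omega)
    · obtain rfl : n = m + 2 := by omega
      exact heq _ hS' _ le_rfl hsub

/-- At the last occurrence of a non-recurring factor starts a privileged block that never returns,
whereas privileged factors are recurring palindromes. -/
theorem factors_eq_recurrentWords_of_ncard [Finite A] {w : ℕ → A}
    (h : ∀ n, (privilegedFactors w n).ncard = if Even n then 1 else 2) (n : ℕ) :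
    factors w n = recurrentWords w n := by
  classical
  refine Set.Subset.antisymm (fun x hx => ⟨hx.1, ?_⟩) (recurrentWords_subset_factors w n)
  by_contra hr
  unfold Recurs at hr
  push Not at hr
  obtain ⟨N, hN⟩ := hr
  obtain ⟨i₀, hi₀⟩ := isFactor_iff.1 hx.2
  have hlt : i₀ < N := by
    by_contra! hle
    exact hN i₀ hle hi₀
  set P : ℕ → Prop := fun i => window w i x.length = x
  set i := Nat.findGreatest P N
  have hPi : P i := Nat.findGreatest_spec (P := P) hlt.le hi₀
  obtain ⟨y, hy1, hy2, hy3⟩ := exists_isPrivileged_last (w := w) (i := i) (n := x.length) (by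
    intro j hj heq
    have hPj : P j := heq.trans hPi
    rcases le_or_gt j N with hjN | hjN
    · exact Nat.findGreatest_is_greatest hj hjN hPj
    · exact hN j hjN.le hPj)
  have hy : y ∈ recurrentPalindromes w y.length := by
    rw [(sturmianUpTo_of_ncard h y.length).2 _ (Nat.le_succ _)]
    exact ⟨⟨rfl, isFactor_iff.2 ⟨i, hy2⟩⟩, hy1⟩
  obtain ⟨j, hj, hjy⟩ := hy.2.1 (i + 1)
  exact hy3 j hj hjy

theorem isSturmian_of_ncard [Finite A] {w : ℕ → A}
    (h : ∀ n, (privilegedFactors w n).ncard = if Even n then 1 else 2) : IsSturmian w := by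
  have hb := binary_of_ncard h
  have hw := not_eventuallyDetermined_of_ncard h
  intro n
  unfold factorComplexity
  rw [factors_eq_recurrentWords_of_ncard h]
  induction n with
  | zero => exact ncard_recurrentWords_zero w
  | succ n ih =>
    obtain ⟨r, hr, hrs⟩ := exists_rightSpecial hw n
    have : {u : List A | u.length = n ∧ RightSpecial w u} = {r} := by
      ext u
      simp only [Set.mem_ofPred_eq, Set.mem_singleton_iff]
      constructor
      · rintro ⟨h1, h2⟩
        exact (sturmianUpTo_of_ncard h n).1.special r u (by omega) (by omega) hrs h2
      · rintro rfl
        exact ⟨hr, hrs⟩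
    rw [ncard_recurrentWords_succ hb hw, ih, this, Set.ncard_singleton]

end PrivilegedWords

theorem mainTheorem1 {A : Type*} [Finite A] (w : ℕ → A) :
    PrivilegedWords.IsSturmian w ↔
      ∀ n : ℕ, PrivilegedWords.privilegedComplexity w n = if Even n then 1 else 2 :=
  ⟨fun h => h.privilegedComplexity_eq, fun h => PrivilegedWords.isSturmian_of_ncard h⟩
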